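/- **Definitions.** For $k,n\ge 1$ let $$\mathrm{IMM}_n^k=\sum_{x\in[n]^k}|x_1x_2\rangle|x_2x_3\rangle\cdots|x_kx_1\rangle\in(\mathbf C^{n\times n})^{\otimes k}$$ be the iterated matrix multiplication tensor, let $\operatorname{rank}$ denote tensor rank over $\mathbf C$ (the least number of simple tensors summing to the tensor), and let $$\omega_k=\inf\{\alpha\in\mathbf R\mid \operatorname{rank}(\mathrm{IMM}_n^k)\in O(n^\alpha)\}.$$ Let $X$ be a finite set and $f:X^k\to\{0,1\}$. A $k$-player quantum protocol of complexity $\log_2 r$ (with $r\ge1$) works as follows: on input $x\in X^k$ the players share the (normalised) state $|x_1\cdots x_k\rangle\otimes\sum_{a=1}^r|a\rangle^{\otimes k}$; player $i$, who holds $|x_i\rangle$ and the $i$-th share of the second factor, applies a quantum operation (a completely positive trace-preserving map, independent of $x$) to his part, with output in $\mathbf C^2\otimes\mathbf C^{d_i}$; finally the $k$ output qubits $\mathbf C^2$ are projected onto $|1\cdots1\rangle$, and the output is $1$ if the projection succeeds and $0$ otherwise. The protocol nondeterministically computes $f$ if it outputs $1$ with nonzero probability on every $x$ with $f(x)=1$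 and with probability zero on every $x$ with $f(x)=0$. $\mathrm{NQ}(f)$ is the minimal complexity of a protocol that nondeterministically computes $f$. The cyclic equality function $\mathrm{EQ}_n^{C_k}:([2^n]\times[2^n])^k\to\{0,1\}$ takes the value $1$ on $((a_1,b_1),\dots,(a_k,b_k))$ if and only if $b_i=a_{i+1}$ for all $i$, indices modulo $k$. **Theorem.** Let $k$ be an odd positive integer. Then $\omega_k<k$. More precisely: 1. for every integer $q\ge2$ we have $\omega_k\le\log_q\frac{(q+1)^k}{2}$, and $\log_q\frac{(q+1)^k}{2}<k$ for all sufficiently large $q$; 2. $\omega_5\le 4.84438$; 3. for every real $c>\omega_k$ we have $\mathrm{NQ}(\mathrm{EQ}_n^{C_k})\le c\,n$ for all sufficiently large $n$; in particular $\mathrm{NQ}(\mathrm{EQ}_n^{C_k})<kn$ for all sufficiently large $n$. -/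

import Mathlib

open Filter Topology Asymptotics
open scoped Matrix

/-! ### Tensors in coordinates

A tensor in `ℂ^{I 1} ⊗ ⋯ ⊗ ℂ^{I k}` is given by its coordinates in the product basis,
a function `(∀ i, I i) → ℂ`. -/

/-- `t` is a sum of `r` simple tensors. -/
def HasRankDecomposition {k : ℕ} {I : Fin k → Type} (t : (∀ i, I i) → ℂ) (r : ℕ) : Prop :=
  ∃ u : Fin r → ∀ i, I i → ℂ, ∀ y, t y = ∑ a, ∏ i, u a i (y i)

/-- The tensor rank: the least number of simple tensors that sum to `t`. -/
noncomputable def tensorRank {k : ℕ} {I : Fin k → Type} (t : (∀ i, I i) → ℂ) : ℕ :=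
  sInf {r | HasRankDecomposition t r}

/-- The iterated matrix multiplication tensor
`∑_{x ∈ [n]^k} |x₁x₂⟩|x₂x₃⟩⋯|x_k x₁⟩` (`finRotate k i` is `i + 1` modulo `k`). -/
noncomputable def immTensor (k n : ℕ) : (Fin k → Fin n × Fin n) → ℂ :=
  fun y => ∑ x : Fin k → Fin n, ∏ i, if y i = (x i, x (finRotate k i)) then 1 else 0

/-- The real numbers `α` with `rank(IMM_n^k) ∈ O(n^α)` as `n → ∞`. -/
def immExponents (k : ℕ) : Set ℝ :=
  {α | (fun n : ℕ => (tensorRank (immTensor k n) : ℝ)) =O[atTop] fun n : ℕ => (n : ℝ) ^ α}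

/-- The exponent `ω_k` of iterated matrix multiplication. -/
noncomputable def immExponent (k : ℕ) : ℝ := sInf (immExponents k)

theorem immTensor_hasRankDecomposition (k n : ℕ) :
    HasRankDecomposition (immTensor k n) (n ^ k) := by
  have hc : Fintype.card (Fin k → Fin n) = n ^ k := by simp
  let e : Fin (n ^ k) ≃ (Fin k → Fin n) := (Fintype.equivFinOfCardEq hc).symm
  refine ⟨fun a i z => if z = (e a i, e a (finRotate k i)) then 1 else 0, fun y => ?_⟩
  exact (Equiv.sum_comp e (fun x : Fin k → Fin n =>
    ∏ i, if y i = (x i, x (finRotate k i)) then (1 : ℂ) else 0)).symm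

theorem one_le_tensorRank_immTensor (k n : ℕ) (hn : 0 < n) :
    1 ≤ tensorRank (immTensor k n) := by
  by_contra h
  have h0 : tensorRank (immTensor k n) = 0 := by omega
  have hm : HasRankDecomposition (immTensor k n) (tensorRank (immTensor k n)) :=
    Nat.sInf_mem (s := {r | HasRankDecomposition (immTensor k n) r})
      ⟨_, immTensor_hasRankDecomposition k n⟩
  rw [h0] at hm
  obtain ⟨u, hu⟩ := hm
  have h1 := hu (fun _ => (⟨0, hn⟩, ⟨0, hn⟩))
  simp only [Finset.univ_eq_empty, Finset.sum_empty, immTensor] at h1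
  rw [Finset.sum_eq_single (fun _ => (⟨0, hn⟩ : Fin n))] at h1
  · simp at h1
  · intro x _ hx
    obtain ⟨i, hi⟩ := Function.ne_iff.mp hx
    refine Finset.prod_eq_zero (Finset.mem_univ i) (if_neg fun h => hi ?_)
    exact (congrArg Prod.fst h).symm
  · simp

/-- The infimum defining `ω_k` is a genuine one: the set is nonempty and bounded below. -/
theorem immExponent_isGLB (k : ℕ) : IsGLB (immExponents k) (immExponent k) := by
  refine isGLB_csInf ⟨(k : ℝ), ?_⟩ ⟨0, ?_⟩
  · refine IsBigO.of_bound 1 (Eventually.of_forall fun n => ?_)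
    have h : tensorRank (immTensor k n) ≤ n ^ k :=
      Nat.sInf_le (immTensor_hasRankDecomposition k n)
    rw [Real.rpow_natCast, one_mul, Real.norm_natCast, norm_pow, Real.norm_natCast]
    exact_mod_cast h
  · intro α hα
    by_contra hneg
    have hlim : Tendsto (fun n : ℕ => (n : ℝ) ^ α) atTop (𝓝 0) := by
      have := (tendsto_rpow_neg_atTop (y := -α) (by linarith)).comp tendsto_natCast_atTop_atTop
      simpa [Function.comp_def] using this
    have h0 := IsBigO.trans_tendsto hα hlim
    have h1 : ∀ᶠ n : ℕ in atTop, (1 : ℝ) ≤ tensorRank (immTensor k n) := by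
      filter_upwards [eventually_gt_atTop 0] with n hn
      exact_mod_cast one_le_tensorRank_immTensor k n hn
    have := ge_of_tendsto h0 h1
    linarith

/-! ### Nondeterministic quantum communication with a shared GHZ state -/

/-- The (unnormalised) `k`-party GHZ state of rank `r`, `∑_{a=1}^r |a⟩|a⟩⋯|a⟩`. -/
noncomputable def ghz (k r : ℕ) : (Fin k → Fin r) → ℂ :=
  fun g => ∑ a : Fin r, ∏ i, if g i = a then 1 else 0

/-- The action of a local operator `A₁ ⊗ ⋯ ⊗ A_k` on a tensor. -/
noncomputable def applyLocal {k : ℕ} {I O : Fin k → Type} [∀ i, Fintype (I i)]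
    (A : ∀ i, Matrix (O i) (I i) ℂ) (t : (∀ i, I i) → ℂ) : (∀ i, O i) → ℂ :=
  fun y => ∑ z, (∏ i, A i (y i) (z i)) * t z

/-- A `k`-player quantum protocol with input set `X` for each player. Player `i` holds an input
register `ℂ^X` and one share `ℂ^r` of a GHZ state of rank `r`, and applies a local quantum
operation (a completely positive trace-preserving map, given by finitely many Kraus operators) into
`ℂ² ⊗ ℂ^{dim i}`; the first tensor factor is the output qubit `R_i`, the second one is work
space. -/
structure QProtocol (k : ℕ) (X : Type) [Fintype X] [DecidableEq X] where
  r : ℕ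
  r_pos : 0 < r
  dim : Fin k → ℕ
  numKraus : Fin k → ℕ
  kraus : ∀ i, Fin (numKraus i) → Matrix (Fin 2 × Fin (dim i)) (X × Fin r) ℂ
  complete : ∀ i, ∑ a, (kraus i a)ᴴ * kraus i a = 1

namespace QProtocol

variable {k : ℕ} {X : Type} [Fintype X] [DecidableEq X]

/-- The initial state `|x₁ ⋯ x_k⟩|GHZ_r⟩`, without the normalisation factor `1/√r`. -/
noncomputable def initialState (P : QProtocol k X) (x : Fin k → X) : (Fin k → X × Fin P.r) → ℂ :=
  fun z => (∏ i, if (z i).1 = x i then 1 else 0) * ghz k P.r (fun i => (z i).2)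

/-- The probability that the protocol outputs `1` on input `x`: the squared norm of the projection
onto `|11⋯1⟩` of the output qubits, summed over all Kraus branches (and divided by the squared norm
`r` of the GHZ state, for `k ≥ 1`). -/
noncomputable def acceptProb (P : QProtocol k X) (x : Fin k → X) : ℝ :=
  (∑ a : (∀ i, Fin (P.numKraus i)), ∑ y : (∀ i, Fin 2 × Fin (P.dim i)),
    if ∀ i, (y i).1 = 1 then
      ‖applyLocal (fun i => P.kraus i (a i)) (P.initialState x) y‖ ^ 2
    else 0) / P.r

/-- The protocol nondeterministically computes `f`. -/
def Computes (P : QProtocol k X) (f : (Fin k → X) → Bool) : Prop :=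
  ∀ x, (f x = true → P.acceptProb x ≠ 0) ∧ (f x = false → P.acceptProb x = 0)

/-- The complexity `log₂ r` of a protocol. -/
noncomputable def complexity (P : QProtocol k X) : ℝ := Real.logb 2 P.r

end QProtocol

/-- The nondeterministic quantum communication complexity `NQ(f)`: the least complexity of a
protocol that nondeterministically computes `f`. -/
noncomputable def NQ {k : ℕ} {X : Type} [Fintype X] [DecidableEq X]
    (f : (Fin k → X) → Bool) : ℝ :=
  sInf {c | ∃ P : QProtocol k X, P.Computes f ∧ P.complexity = c}

theorem QProtocol.acceptProb_ne_zero_iff {k : ℕ} {X : Type} [Fintype X] [DecidableEq X]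
    (P : QProtocol k X) (x : Fin k → X) :
    P.acceptProb x ≠ 0 ↔ ∃ (a : ∀ i, Fin (P.numKraus i)) (y : ∀ i, Fin 2 × Fin (P.dim i)),
      (∀ i, (y i).1 = 1) ∧
        applyLocal (fun i => P.kraus i (a i)) (P.initialState x) y ≠ 0 := by
  have hr : (P.r : ℝ) ≠ 0 := by exact_mod_cast P.r_pos.ne'
  have hnn : ∀ (a : ∀ i, Fin (P.numKraus i)) (y : ∀ i, Fin 2 × Fin (P.dim i)),
      (0 : ℝ) ≤ if ∀ i, (y i).1 = 1 then
        ‖applyLocal (fun i => P.kraus i (a i)) (P.initialState x) y‖ ^ 2 else 0 := by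
    intro a y; split_ifs <;> positivity
  rw [← not_iff_not, not_not, acceptProb, div_eq_zero_iff, or_iff_left hr,
    Finset.sum_eq_zero_iff_of_nonneg fun a _ => Finset.sum_nonneg fun y _ => hnn a y]
  push Not
  refine forall_congr' fun a => ?_
  rw [imp_iff_right (Finset.mem_univ _), Finset.sum_eq_zero_iff_of_nonneg fun y _ => hnn a y]
  refine forall_congr' fun y => ?_
  rw [imp_iff_right (Finset.mem_univ _)]
  by_cases h : ∀ i, (y i).1 = 1
  · simp [h]
  · rw [if_neg h]; exact ⟨fun _ h' => absurd h' h, fun _ => rfl⟩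

/-- Some protocol computes `f`. -/
theorem exists_protocol {k : ℕ} (hk : 0 < k) {X : Type} [Fintype X] [DecidableEq X] [Nonempty X]
    (f : (Fin k → X) → Bool) : ∃ P : QProtocol k X, P.Computes f := by
  let R := Fintype.card (Fin k → X)
  let e : Fin R ≃ (Fin k → X) := (Fintype.equivFin _).symm
  let w : X × Fin R ≃ Fin (Fintype.card (X × Fin R)) := Fintype.equivFin _
  let φ : Fin k → X × Fin R → Fin 2 × Fin (Fintype.card (X × Fin R)) := fun i z =>
    (if f (e z.2) = true ∧ e z.2 i = z.1 then 1 else 0, w z)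
  have hφ : ∀ i, Function.Injective (φ i) := fun i z z' h => w.injective (congrArg Prod.snd h)
  let P : QProtocol k X :=
    { r := R
      r_pos := Fintype.card_pos
      dim := fun _ => Fintype.card (X × Fin R)
      numKraus := fun _ => 1
      kraus := fun i _ => Matrix.of fun y z => if y = φ i z then 1 else 0
      complete := by
        intro i
        ext z z'
        simp only [Finset.univ_unique, Finset.sum_singleton, Matrix.mul_apply,
          Matrix.conjTranspose_apply, Matrix.of_apply, Matrix.one_apply]
        rw [Finset.sum_eq_single (φ i z')]
        · by_cases h : z = z'
          · simp [h]
          · have : φ i z' ≠ φ i z := fun h' => h (hφ i h').symm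
            simp [h, this]
        · intro y _ hy; simp [hy]
        · simp }
  have hamp : ∀ (a : ∀ i, Fin (P.numKraus i)) (x : Fin k → X)
      (y : ∀ i, Fin 2 × Fin (P.dim i)), applyLocal (fun i => P.kraus i (a i)) (P.initialState x) y ≠ 0 ↔
      ∃ g : Fin R, y = fun i => φ i (x i, g) := by
    intro a x y
    have hprod : ∀ z : Fin k → X × Fin R,
        (∏ i, P.kraus i (a i) (y i) (z i)) = if ∀ i, y i = φ i (z i) then 1 else 0 := by
      intro z
      by_cases h : ∀ i, y i = φ i (z i)
      · rw [if_pos h]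
        exact Finset.prod_eq_one fun i _ => if_pos (h i)
      · rw [if_neg h]
        push Not at h
        obtain ⟨i, hi⟩ := h
        exact Finset.prod_eq_zero (Finset.mem_univ i) (if_neg hi)
    have hghz : ∀ g : Fin k → Fin R, ghz k R g ≠ 0 ↔ ∃ b, ∀ i, g i = b := by
      intro g
      have : ∀ b : Fin R, (∏ i, if g i = b then (1 : ℂ) else 0) =
          if ∀ i, g i = b then 1 else 0 := by
        intro b
        by_cases h : ∀ i, g i = b
        · simp [h]
        · rw [if_neg h]
          push Not at h
          obtain ⟨i, hi⟩ := h
          exact Finset.prod_eq_zero (Finset.mem_univ i) (if_neg hi)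
      simp only [ghz, this, Finset.sum_boole]
      rw [Nat.cast_ne_zero, Finset.card_ne_zero]
      constructor
      · rintro ⟨b, hb⟩
        exact ⟨b, (Finset.mem_filter.mp hb).2⟩
      · rintro ⟨b, hb⟩
        exact ⟨b, Finset.mem_filter.mpr ⟨Finset.mem_univ _, hb⟩⟩
    have hinit : ∀ z : Fin k → X × Fin R,
        P.initialState x z ≠ 0 ↔ ∃ g : Fin R, z = fun i => (x i, g) := by
      intro z
      simp only [QProtocol.initialState]
      rw [mul_ne_zero_iff, Finset.prod_ne_zero_iff]
      refine (and_congr_right' (hghz fun i => (z i).2)).trans ?_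
      constructor
      · rintro ⟨h1, b, hb⟩
        refine ⟨b, funext fun i => Prod.ext ?_ (hb i)⟩
        by_contra h
        exact h1 i (Finset.mem_univ i) (if_neg h)
      · rintro ⟨b, rfl⟩
        exact ⟨by simp, b, fun _ => rfl⟩
    simp only [applyLocal]
    constructor
    · intro h
      obtain ⟨z, _, hz⟩ := Finset.exists_ne_zero_of_sum_ne_zero h
      rw [mul_ne_zero_iff, hinit] at hz
      obtain ⟨h1, g, rfl⟩ := hz
      refine ⟨g, funext fun i => ?_⟩
      rw [hprod] at h1
      by_contra h
      exact h1 (if_neg fun h' => h (h' i))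
    · rintro ⟨g, rfl⟩
      rw [Finset.sum_eq_single (fun i => (x i, g))]
      · rw [mul_ne_zero_iff, hinit, hprod]
        exact ⟨by simp, g, rfl⟩
      · intro z _ hz
        rw [hprod, if_neg, zero_mul]
        exact fun h => hz (funext fun i => (hφ i (h i)).symm)
      · simp
  refine ⟨P, fun x => ?_⟩
  have hacc : P.acceptProb x ≠ 0 ↔ f x = true := by
    rw [QProtocol.acceptProb_ne_zero_iff]
    constructor
    · rintro ⟨a, y, hy, h⟩
      obtain ⟨g, rfl⟩ := (hamp a x y).mp h
      have hg : ∀ i, f (e g) = true ∧ e g i = x i := by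
        intro i
        by_contra h'
        have := hy i
        simp only [φ] at this
        rw [if_neg h'] at this
        exact absurd this (by decide)
      rw [← (funext fun i => (hg i).2 : e g = x)]
      exact (hg ⟨0, hk⟩).1
    · intro hf
      refine ⟨fun _ => 0, fun i => φ i (x i, e.symm x), fun i => ?_, (hamp _ _ _).mpr ⟨_, rfl⟩⟩
      simp [φ, hf]
  refine ⟨hacc.mpr, fun hf => ?_⟩
  by_contra h
  simp [hacc.mp h] at hf

/-- `NQ(f)` is an attained minimum over protocols. -/
theorem NQ_isLeast {k : ℕ} (hk : 0 < k) {X : Type} [Fintype X] [DecidableEq X] [Nonempty X]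
    (f : (Fin k → X) → Bool) :
    IsLeast {c | ∃ P : QProtocol k X, P.Computes f ∧ P.complexity = c} (NQ f) := by
  classical
  have hex : ∃ r : ℕ, ∃ P : QProtocol k X, P.Computes f ∧ P.r = r := by
    obtain ⟨P, hP⟩ := exists_protocol hk f
    exact ⟨_, P, hP, rfl⟩
  obtain ⟨P, hP, hr⟩ := Nat.find_spec hex
  have hl : IsLeast {c | ∃ P : QProtocol k X, P.Computes f ∧ P.complexity = c} P.complexity := by
    refine ⟨⟨P, hP, rfl⟩, ?_⟩
    rintro c ⟨Q, hQ, rfl⟩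
    have hle : P.r ≤ Q.r := hr ▸ Nat.find_min' hex ⟨Q, hQ, rfl⟩
    refine Real.logb_le_logb_of_le (by norm_num) ?_ (by exact_mod_cast hle)
    exact_mod_cast P.r_pos
  rw [NQ, hl.csInf_eq]
  exact hl

/-- The cyclic equality function `EQ_n^{C_k}` on `([2^n] × [2^n])^k`: player `i` holds `(a_i, b_i)`,
and the value is `1` iff `b_i = a_{i+1}` for all `i` modulo `k`. -/
def cyclicEq (n k : ℕ) : (Fin k → Fin (2 ^ n) × Fin (2 ^ n)) → Bool :=
  fun x => decide (∀ i, (x i).2 = (x (finRotate k i)).1)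

/-!
The iterated matrix multiplication tensor is a product of maximally entangled pairs, one on each
edge of a `k`-cycle. For every `j` take a three-party tensor in the style of Strassen, of rank at
most `q + 1`, held by the centre `j` and the outer parties `j - 1` and `j + 1`: it contains a pair
of dimension `q` on the edge `{j - 1, j}` and one on the edge `{j, j + 1}`, and it vanishes where
neither outer party takes part (`sum_centreVec_mul_outerVec`). In the product over all `j`, of rank
at most `(q + 1) ^ k`, let each party use the same orientation in all three tensors it takes part
in. A nonzero coordinate then forces the orientation to be monotone along `j - 1 ↦ j + 1`; for odd
`k` these steps form a single cycle (`finRotate_sq_induction`), so all the parties have the same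
orientation, and both orientations give a copy of the tensor of size `q`. Hence two disjoint copies
of it have rank at most `(q + 1) ^ k` (`immSum_bool_hasRankDecomposition`).

As in the asymptotic sum inequality, such a saving on a direct sum can be used recursively: `s`
copies of the tensor of size `q ^ (m + 1)` reduce to `(q + 1) ^ k * ⌈s / 2⌉` copies of the one of
size `q ^ m` (`immSum_mul_hasRankDecomposition`). With `ρ = (q + 1) ^ k / 2 > 1` the rank of the
tensor of size `q ^ m` is thus `O(ρ ^ m)`, which gives the exponent `log_q ρ`
(`logb_mem_immExponents`). Here `ρ < q ^ k` for large `q`, and `q = 31` gives the bound for `k = 5`.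

For the communication problem, a tensor whose support is `f⁻¹(1)` and whose rank is `r` gives a
protocol with a GHZ state of rank `r`: each player projects his share onto the coefficient vector
of his input (`exists_protocol_of_hasRankDecomposition`). For cyclic equality on `n` bits the
matrix multiplication tensor of size `2 ^ n` has the right support.
-/

/-! ### Rank decompositions -/

theorem hasRankDecomposition_of_fintype {k : ℕ} {I : Fin k → Type} {t : (∀ i, I i) → ℂ}
    {α : Type} [Fintype α] (u : α → ∀ i, I i → ℂ) (hu : ∀ y, t y = ∑ a, ∏ i, u a i (y i)) :
    HasRankDecomposition t (Fintype.card α) :=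
  ⟨fun a => u ((Fintype.equivFin α).symm a), fun y => by
    rw [hu, ← Equiv.sum_comp (Fintype.equivFin α).symm]⟩

/-- A tensor obtained by relabelling the basis vectors of each factor (possibly dropping or
repeating some) has no larger rank. -/
theorem HasRankDecomposition.comap {k : ℕ} {I J : Fin k → Type} {t : (∀ i, I i) → ℂ} {r : ℕ}
    (h : HasRankDecomposition t r) (φ : ∀ i, J i → I i) :
    HasRankDecomposition (fun y : ∀ i, J i => t fun i => φ i (y i)) r := by
  obtain ⟨u, hu⟩ := h
  exact ⟨fun a i z => u a i (φ i z), fun y => hu _⟩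

theorem tensorRank_le {k : ℕ} {I : Fin k → Type} {t : (∀ i, I i) → ℂ} {r : ℕ}
    (h : HasRankDecomposition t r) : tensorRank t ≤ r :=
  Nat.sInf_le h

theorem tensorRank_spec {k : ℕ} {I : Fin k → Type} {t : (∀ i, I i) → ℂ} {r : ℕ}
    (h : HasRankDecomposition t r) : HasRankDecomposition t (tensorRank t) :=
  Nat.sInf_mem (s := {r | HasRankDecomposition t r}) ⟨r, h⟩

/-! ### Going around the cycle -/

theorem finRotate_induction {k : ℕ} {P : Fin k → Prop} (h : ∀ i, P i → P (finRotate k i))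
    (i j : Fin k) (hi : P i) : P j := by
  obtain _ | k := k
  · exact i.elim0
  have key : ∀ n : ℕ, P (i + Fin.ofNat (k + 1) n) := by
    intro n
    induction n with
    | zero => simpa using hi
    | succ n ih =>
      have := h _ ih
      rw [finRotate_apply] at this
      convert this using 1
      ext
      simp [Fin.val_add, add_assoc]
  have := key (j - i).val
  simpa using this

/-- On a cycle of odd length, steps of length two reach every vertex. -/
theorem finRotate_sq_induction {k : ℕ} (hk : Odd k) {P : Fin k → Prop}
    (h : ∀ i, P i → P (finRotate k (finRotate k i))) (i j : Fin k) (hi : P i) : P j := by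
  obtain ⟨m, rfl⟩ := hk
  refine finRotate_induction (fun l hl => ?_) i j hi
  have key : ∀ n : ℕ, P (l + Fin.ofNat (2 * m + 1) (2 * n)) := by
    intro n
    induction n with
    | zero => simpa using hl
    | succ n ih =>
      have := h _ ih
      rw [finRotate_apply, finRotate_apply] at this
      convert this using 1
      ext
      simp [Fin.val_add, add_assoc, mul_add]
  -- A full turn and one step, `2 * m + 2 = 2 * (m + 1)`, is an even number of steps.
  have := key (m + 1)
  rw [finRotate_apply]
  convert this using 2
  ext
  have : 2 * (m + 1) = 1 + (2 * m + 1) := by ring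
  simp [this]

/-! ### Direct sums of matrix multiplication tensors -/

/-- The direct sum over `σ` of copies of the iterated matrix multiplication tensor on `ι × ι`
matrices. In a basis vector `(s, a, b)` of one factor, `s` names the copy and `(a, b)` the matrix
entry. -/
noncomputable def immSum (k : ℕ) (σ ι : Type) [DecidableEq σ] [DecidableEq ι] :
    (Fin k → σ × ι × ι) → ℂ :=
  fun y => ∏ i, if (y i).1 = (y (finRotate k i)).1 ∧ (y i).2.2 = (y (finRotate k i)).2.1
    then 1 else 0

theorem immTensor_eq_prod (k n : ℕ) (y : Fin k → Fin n × Fin n) :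
    immTensor k n y = ∏ i, if (y i).2 = (y (finRotate k i)).1 then 1 else 0 := by
  have h : ∀ x : Fin k → Fin n, (∏ i, if y i = (x i, x (finRotate k i)) then (1 : ℂ) else 0) =
      if x = fun i => (y i).1 then ∏ i, if (y i).2 = (y (finRotate k i)).1 then 1 else 0
        else 0 := by
    intro x
    split_ifs with hx
    · subst hx
      exact Finset.prod_congr rfl fun i _ => if_congr (by simp [Prod.ext_iff]) rfl rfl
    · obtain ⟨i, hi⟩ := Function.ne_iff.mp hx
      exact Finset.prod_eq_zero (Finset.mem_univ i) (if_neg fun h => hi (by rw [h]))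
  simp only [immTensor, h, Finset.sum_ite_eq', Finset.mem_univ, if_true]

theorem immSum_comap_hasRankDecomposition {k r : ℕ} {σ σ' ι ι' : Type} [DecidableEq σ]
    [DecidableEq ι] [DecidableEq σ'] [DecidableEq ι'] {f : σ' → σ} {g : ι' → ι}
    (hf : f.Injective) (hg : g.Injective) (h : HasRankDecomposition (immSum k σ ι) r) :
    HasRankDecomposition (immSum k σ' ι') r := by
  convert h.comap (fun _ (z : σ' × ι' × ι') => (f z.1, g z.2.1, g z.2.2)) using 2 with y
  simp only [immSum, hf.eq_iff, hg.eq_iff]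

theorem immTensor_hasRankDecomposition_of_immSum {k r n m : ℕ} (hnm : n ≤ m)
    (h : HasRankDecomposition (immSum k (Fin 1) (Fin m)) r) :
    HasRankDecomposition (immTensor k n) r := by
  convert h.comap (fun _ (z : Fin n × Fin n) =>
    ((0 : Fin 1), Fin.castLE hnm z.1, Fin.castLE hnm z.2)) using 2 with y
  simp only [immTensor_eq_prod, immSum, true_and, (Fin.castLE_injective hnm).eq_iff]

theorem prod_delta_eq_sum {k : ℕ} (hk : 0 < k) {σ : Type} [Fintype σ] [DecidableEq σ]
    (s : Fin k → σ) :
    (∏ i, if s i = s (finRotate k i) then (1 : ℂ) else 0) =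
      ∑ a : σ, ∏ i, if s i = a then 1 else 0 := by
  simp only [Finset.prod_boole, Finset.mem_univ, forall_const]
  rw [Finset.sum_boole]
  split_ifs with h
  · have hc : ∀ i, s i = s ⟨0, hk⟩ := fun i =>
      finRotate_induction (P := fun i => s i = s ⟨0, hk⟩) (fun i hi => by rw [← h i, hi])
        ⟨0, hk⟩ i rfl
    rw [show ({a | ∀ i, s i = a} : Finset σ) = {s ⟨0, hk⟩} from ?_]
    · simp
    · ext a
      simp only [Finset.mem_filter, Finset.mem_univ, true_and, Finset.mem_singleton]
      exact ⟨fun h => (h _).symm, fun h => h ▸ hc⟩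
  · rw [Finset.filter_false_of_mem]
    · simp
    · exact fun a _ ha => h fun i => by rw [ha, ha]

theorem immSum_one_hasRankDecomposition {k : ℕ} (hk : 0 < k) (s : ℕ) :
    HasRankDecomposition (immSum k (Fin s) (Fin 1)) s := by
  have := hasRankDecomposition_of_fintype (t := immSum k (Fin s) (Fin 1)) (α := Fin s)
    (fun a i z => if z.1 = a then 1 else 0) (fun y => by
      rw [← prod_delta_eq_sum hk fun i => (y i).1]
      exact Finset.prod_congr rfl fun i _ => if_congr
        (and_iff_left_of_imp fun _ => Subsingleton.elim _ _) rfl rfl)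
  simpa using this

/-- If a direct sum of `τ` copies of the `κ × κ` tensor has rank at most `|α|`, then it is a
restriction of the diagonal tensor on `α`. Hence in a direct sum of `τ × σ` copies of the
`(κ × ι) × (κ × ι)` tensor one may replace the part labelled by `τ` and `κ` by `α`. -/
theorem immSum_prod_hasRankDecomposition {k R r : ℕ} (hk : 0 < k) {τ σ κ ι : Type}
    [DecidableEq τ] [DecidableEq σ] [DecidableEq κ] [DecidableEq ι]
    (h₁ : HasRankDecomposition (immSum k τ κ) R)
    (h₂ : HasRankDecomposition (immSum k (Fin R × σ) ι) r) :
    HasRankDecomposition (immSum k (τ × σ) (κ × ι)) r := by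
  obtain ⟨u, hu⟩ := h₁
  obtain ⟨v, hv⟩ := h₂
  refine ⟨fun b i z => ∑ a, u a i (z.1.1, z.2.1.1, z.2.2.1) *
    v b i ((a, z.1.2), z.2.1.2, z.2.2.2), fun y => ?_⟩
  have hsplit : immSum k (τ × σ) (κ × ι) y =
      immSum k τ κ (fun i => ((y i).1.1, (y i).2.1.1, (y i).2.2.1)) *
      immSum k σ ι (fun i => ((y i).1.2, (y i).2.1.2, (y i).2.2.2)) := by
    simp only [immSum, ← Finset.prod_mul_distrib, Prod.ext_iff, ite_zero_mul_ite_zero, mul_one]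
    exact Finset.prod_congr rfl fun i _ => if_congr (by tauto) rfl rfl
  have hdiag : ∀ a : Fin k → Fin R,
      immSum k (Fin R × σ) ι (fun i => ((a i, (y i).1.2), (y i).2.1.2, (y i).2.2.2)) =
      (∑ c : Fin R, ∏ i, if a i = c then (1 : ℂ) else 0) *
      immSum k σ ι (fun i => ((y i).1.2, (y i).2.1.2, (y i).2.2.2)) := by
    intro a
    rw [← prod_delta_eq_sum hk]
    simp only [immSum, ← Finset.prod_mul_distrib, Prod.ext_iff, ite_zero_mul_ite_zero, mul_one]
    exact Finset.prod_congr rfl fun i _ => if_congr (by tauto) rfl rfl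
  have hconst : ∀ (c : Fin R) (f : (Fin k → Fin R) → ℂ),
      ∑ a : Fin k → Fin R, f a * (∏ i, if a i = c then (1 : ℂ) else 0) = f fun _ => c := by
    intro c f
    simp only [Finset.prod_boole, Finset.mem_univ, forall_const, mul_ite, mul_one, mul_zero]
    simp only [← funext_iff (g := fun _ => c), Finset.sum_ite_eq', Finset.mem_univ, if_true]
  simp only [Finset.prod_univ_sum, Fintype.piFinset_univ]
  rw [Finset.sum_comm]
  simp only [Finset.prod_mul_distrib, ← Finset.mul_sum, ← hv, hdiag, hsplit, hu]
  simp only [← mul_assoc, ← Finset.sum_mul, Finset.mul_sum]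
  rw [Finset.sum_comm]
  simp only [hconst]

/-! ### Two disjoint copies at the price of `(q + 1) ^ k` -/

/-- The factor held by an outer party in term `α` of the three-party tensor
`∑ i, (e₀ + e_i) ⊗ e_i ⊗ (e₀ + e_i) - e₀ ⊗ (∑ i, e_i) ⊗ e₀` in the style of Strassen, a sum of
`|ι| + 1` simple tensors. The label `some i` is the `i`-th term of the sum and `none` the subtracted
term; the coordinate `none` stands for `e₀` and `some j` for `e_j`. -/
def outerVec {ι : Type} [DecidableEq ι] (α l : Option ι) : ℂ :=
  match α, l with
  | _, none => 1
  | none, some _ => 0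
  | some i, some j => if i = j then 1 else 0

/-- The factor held by the central party in term `α` of the tensor described at `outerVec`; it
carries the sign of the subtracted term. -/
def centreVec {ι : Type} [DecidableEq ι] (α : Option ι) (c : ι) : ℂ :=
  match α with
  | none => -1
  | some i => if i = c then 1 else 0

/-- The coordinates of the three-party tensor. Its only vanishing block is the one where both
outer parties are at `e₀`; where exactly one of them is, it is a maximally entangled pair of the
centre and the other outer party. -/
theorem sum_centreVec_mul_outerVec {ι : Type} [Fintype ι] [DecidableEq ι] (c : ι)
    (l r : Option ι) :
    ∑ α, centreVec α c * outerVec α l * outerVec α r =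
      if l = none ∧ r = none then 0 else
        if (∀ b ∈ l, b = c) ∧ (∀ a ∈ r, a = c) then 1 else 0 := by
  rw [Fintype.sum_option]
  rcases l with _ | l <;> rcases r with _ | r <;>
    simp [centreVec, outerVec, eq_comm, ite_and]
  split_ifs <;> simp_all

/-- Two copies of the tensor of size `q` cost only `(q + 1) ^ k`. The tensor used is the product
over all `j` of three-party tensors with centre `j` and outer parties `j - 1` and `j + 1`. Copy
`false` of the matrix multiplication tensor pairs every centre `j` with `j - 1`, and copy `true`
pairs it with `j + 1`. -/
theorem immSum_bool_hasRankDecomposition {k : ℕ} (hk : Odd k) (q : ℕ) :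
    HasRankDecomposition (immSum k Bool (Fin q)) ((q + 1) ^ k) := by
  have hc : Fintype.card (Fin k → Option (Fin q)) = (q + 1) ^ k := by simp
  rw [← hc]
  refine hasRankDecomposition_of_fintype (fun a p z =>
    centreVec (a p) (if z.1 then z.2.2 else z.2.1) *
    outerVec (a (finRotate k p)) (if z.1 then none else some z.2.2) *
    outerVec (a ((finRotate k).symm p)) (if z.1 then some z.2.1 else none)) fun y => ?_
  -- Regroup the factors by the party at the centre, and sum over each label separately.
  have hre : ∀ a : Fin k → Option (Fin q),
      (∏ p, centreVec (a p) (if (y p).1 then (y p).2.2 else (y p).2.1) *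
        outerVec (a (finRotate k p)) (if (y p).1 then none else some (y p).2.2) *
        outerVec (a ((finRotate k).symm p)) (if (y p).1 then some (y p).2.1 else none)) =
      ∏ j, centreVec (a j) (if (y j).1 then (y j).2.2 else (y j).2.1) *
        outerVec (a j) (if (y ((finRotate k).symm j)).1 then none
          else some (y ((finRotate k).symm j)).2.2) *
        outerVec (a j) (if (y (finRotate k j)).1 then some (y (finRotate k j)).2.1
          else none) := by
    intro a
    simp only [Finset.prod_mul_distrib]
    congr 1
    · congr 1
      rw [← Equiv.prod_comp (finRotate k) fun j => outerVec (a j) (if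
        (y ((finRotate k).symm j)).1 then none else some (y ((finRotate k).symm j)).2.2)]
      simp only [Equiv.symm_apply_apply]
    · rw [← Equiv.prod_comp (finRotate k) fun p => outerVec (a ((finRotate k).symm p)) (if
        (y p).1 then some (y p).2.1 else none)]
      simp only [Equiv.symm_apply_apply]
  simp only [hre]
  have hps := Finset.prod_univ_sum (fun _ : Fin k => (Finset.univ : Finset (Option (Fin q))))
    (fun j α => centreVec α (if (y j).1 then (y j).2.2 else (y j).2.1) *
        outerVec α (if (y ((finRotate k).symm j)).1 then none
          else some (y ((finRotate k).symm j)).2.2) *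
        outerVec α (if (y (finRotate k j)).1 then some (y (finRotate k j)).2.1
          else none))
  rw [Fintype.piFinset_univ] at hps
  rw [← hps]
  simp only [sum_centreVec_mul_outerVec]
  by_cases h : ∃ j, (y ((finRotate k).symm j)).1 = true ∧ (y (finRotate k j)).1 = false
  · obtain ⟨j, h1, h2⟩ := h
    rw [Finset.prod_eq_zero (i := j) (Finset.mem_univ j) (by rw [h1, h2]; simp), immSum,
      Finset.prod_boole, if_neg]
    intro hall
    have e1 := (hall ((finRotate k).symm j) (Finset.mem_univ _)).1
    have e2 := (hall j (Finset.mem_univ _)).1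
    rw [Equiv.apply_symm_apply] at e1
    rw [← e2, ← e1, h1] at h2
    exact absurd h2 (by decide)
  · -- The copy label never drops along `j - 1 ↦ j + 1`, so it is constant.
    have hmono : ∀ i, (y i).1 = true → (y (finRotate k (finRotate k i))).1 = true := by
      intro i hi
      by_contra h'
      exact h ⟨finRotate k i, by rwa [Equiv.symm_apply_apply],
        by simpa only [Bool.not_eq_true] using h'⟩
    by_cases hex : ∃ i, (y i).1 = true
    · obtain ⟨i, hi⟩ := hex
      have hall : ∀ j, (y j).1 = true := fun j =>
        finRotate_sq_induction hk (P := fun i => (y i).1 = true) hmono i j hi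
      simp [immSum, hall, eq_comm]
    · have hall : ∀ j, (y j).1 = false := by simpa using hex
      refine Eq.trans ?_ (Equiv.prod_comp (finRotate k) _)
      simp [immSum, hall, -finRotate_apply, -finRotate_symm_apply]

/-! ### The recursion for the rank of large powers -/

/-- One step of the recursion: `s` copies of the tensor of size `q * n` fit into `⌈s / 2⌉` pairs,
and the pair of copies of the tensor of size `q` can be exchanged for `(q + 1) ^ k` labels. -/
theorem immSum_mul_hasRankDecomposition {k : ℕ} (hk : Odd k) {q n s r : ℕ}
    (h : HasRankDecomposition (immSum k (Fin ((q + 1) ^ k * ((s + 1) / 2))) (Fin n)) r) :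
    HasRankDecomposition (immSum k (Fin s) (Fin (q * n))) r := by
  have h' : HasRankDecomposition
      (immSum k (Fin ((q + 1) ^ k) × Fin ((s + 1) / 2)) (Fin n)) r :=
    immSum_comap_hasRankDecomposition finProdFinEquiv.injective Function.injective_id h
  have h'' := immSum_prod_hasRankDecomposition hk.pos (immSum_bool_hasRankDecomposition hk q) h'
  have hs : s ≤ 2 * ((s + 1) / 2) := by omega
  exact immSum_comap_hasRankDecomposition
    (f := fun a => Prod.map finTwoEquiv id (finProdFinEquiv.symm (Fin.castLE hs a)))
    ((finTwoEquiv.injective.prodMap Function.injective_id).comp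
      (finProdFinEquiv.symm.injective.comp (Fin.castLE_injective hs)))
    finProdFinEquiv.symm.injective h''

/-- Iterating the step `s ↦ (q + 1) ^ k * ⌈s / 2⌉ ≤ ρ * (s + 1)`, an affine map with fixed point
`-c`, bounds the rank of `s` copies of the tensor of size `q ^ m`. -/
theorem exists_immSum_pow_hasRankDecomposition {k : ℕ} (hk : Odd k) {q : ℕ} {ρ c : ℝ}
    (hρ : ρ = ((q : ℝ) + 1) ^ k / 2) (hc : ρ + c = ρ * c) (m s : ℕ) :
    ∃ r : ℕ, HasRankDecomposition (immSum k (Fin s) (Fin (q ^ m))) r ∧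
      (r : ℝ) ≤ (s + c) * ρ ^ m - c := by
  induction m generalizing s with
  | zero => exact ⟨s, immSum_one_hasRankDecomposition hk.pos s, by simp⟩
  | succ m ih =>
    obtain ⟨r, hr, hle⟩ := ih ((q + 1) ^ k * ((s + 1) / 2))
    rw [pow_succ']
    refine ⟨r, immSum_mul_hasRankDecomposition hk hr, hle.trans ?_⟩
    have hρ0 : 0 ≤ ρ := by rw [hρ]; positivity
    have h1 : (((s + 1) / 2 : ℕ) : ℝ) ≤ ((s : ℝ) + 1) / 2 := by
      have := Nat.cast_div_le (α := ℝ) (m := s + 1) (n := 2)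
      exact_mod_cast this
    have h2 : (((q + 1) ^ k * ((s + 1) / 2) : ℕ) : ℝ) ≤ ρ * (s + 1) := by
      have : (((q + 1) ^ k * ((s + 1) / 2) : ℕ) : ℝ) =
        ((q : ℝ) + 1) ^ k * (((s + 1) / 2 : ℕ) : ℝ) := by push_cast; rfl
      rw [this, hρ]
      calc _ ≤ ((q : ℝ) + 1) ^ k * (((s : ℝ) + 1) / 2) := by gcongr
        _ = _ := by ring
    calc _ ≤ (ρ * (s + 1) + c) * ρ ^ m - c := by gcongr
      _ = _ := by rw [pow_succ]; linear_combination ρ ^ m * hc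

theorem one_lt_half_pow {k q : ℕ} (hk : 0 < k) (hq : 2 ≤ q) : 1 < ((q : ℝ) + 1) ^ k / 2 := by
  have h2 : (2 : ℝ) ≤ q := by exact_mod_cast hq
  have : (q : ℝ) + 1 ≤ ((q : ℝ) + 1) ^ k := le_self_pow₀ (by linarith) hk.ne'
  linarith

/-- The exponent `log_q ((q + 1) ^ k / 2)` is attained, with a constant and no lower order
terms. -/
theorem logb_mem_immExponents {k : ℕ} (hk : Odd k) {q : ℕ} (hq : 2 ≤ q) :
    Real.logb q (((q : ℝ) + 1) ^ k / 2) ∈ immExponents k := by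
  obtain ⟨ρ, hρ⟩ : ∃ ρ : ℝ, ρ = ((q : ℝ) + 1) ^ k / 2 := ⟨_, rfl⟩
  have hρ1 : 1 < ρ := hρ ▸ one_lt_half_pow hk.pos hq
  rw [← hρ]
  have hq1 : (1 : ℝ) < q := by exact_mod_cast hq
  have hc : ρ + ρ / (ρ - 1) = ρ * (ρ / (ρ - 1)) := by
    have : ρ - 1 ≠ 0 := by linarith
    field_simp
    ring
  have hc0 : 0 < ρ / (ρ - 1) := div_pos (by linarith) (by linarith)
  set c := ρ / (ρ - 1)
  have hβ : 0 ≤ Real.logb q ρ := Real.logb_nonneg hq1 hρ1.le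
  refine IsBigO.of_bound ((1 + c) * ρ) ?_
  filter_upwards [eventually_gt_atTop 0] with n hn
  obtain ⟨r, hr, hle⟩ := exists_immSum_pow_hasRankDecomposition hk hρ hc (Nat.log q n + 1) 1
  have hrank : (tensorRank (immTensor k n) : ℝ) ≤ r := by
    exact_mod_cast tensorRank_le (immTensor_hasRankDecomposition_of_immSum
      (Nat.lt_pow_succ_log_self (by omega) n).le hr)
  have hpow : ρ ^ Nat.log q n ≤ (n : ℝ) ^ Real.logb q ρ := by
    have h1 : ((q : ℝ) ^ Nat.log q n) ≤ n := by exact_mod_cast Nat.pow_log_le_self q hn.ne'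
    calc ρ ^ Nat.log q n = ((q : ℝ) ^ Real.logb q ρ) ^ Nat.log q n := by
          rw [Real.rpow_logb (by linarith) hq1.ne' (by linarith)]
      _ = ((q : ℝ) ^ Nat.log q n) ^ Real.logb q ρ := by
          rw [← Real.rpow_natCast, ← Real.rpow_mul (by linarith), mul_comm,
            Real.rpow_mul (by linarith), Real.rpow_natCast]
      _ ≤ _ := Real.rpow_le_rpow (by positivity) h1 hβ
  rw [Real.norm_natCast, Real.norm_of_nonneg (by positivity)]
  push_cast at hle
  calc (tensorRank (immTensor k n) : ℝ) ≤ (1 + c) * ρ ^ (Nat.log q n + 1) := by linarith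
    _ = (1 + c) * ρ * ρ ^ Nat.log q n := by ring
    _ ≤ _ := by gcongr

/-! ### Numerical consequences -/

theorem immExponent_le_logb {k : ℕ} (hk : Odd k) {q : ℕ} (hq : 2 ≤ q) :
    immExponent k ≤ Real.logb q (((q : ℝ) + 1) ^ k / 2) :=
  (immExponent_isGLB k).1 (logb_mem_immExponents hk hq)

theorem eventually_logb_lt (k : ℕ) :
    ∀ᶠ q : ℕ in atTop, Real.logb q (((q : ℝ) + 1) ^ k / 2) < k := by
  have hlim : Tendsto (fun q : ℕ => (1 + 1 / (q : ℝ)) ^ k) atTop (𝓝 1) := by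
    simpa using (tendsto_one_div_atTop_nhds_zero_nat (𝕜 := ℝ)).const_add 1 |>.pow k
  filter_upwards [hlim.eventually_lt_const one_lt_two, eventually_gt_atTop 1] with q h hq
  have hq1 : (1 : ℝ) < q := by exact_mod_cast hq
  rw [Real.logb_lt_iff_lt_rpow hq1 (by positivity), Real.rpow_natCast]
  have h1 : (q : ℝ) + 1 = q * (1 + 1 / q) := by field_simp
  have : (q : ℝ) ^ k * (1 + 1 / (q : ℝ)) ^ k < q ^ k * 2 := by gcongr
  rw [h1, mul_pow]
  linarith

theorem immExponent_lt {k : ℕ} (hk : Odd k) : immExponent k < k := by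
  obtain ⟨q, h, hq⟩ := ((eventually_logb_lt k).and (eventually_ge_atTop 2)).exists
  exact (immExponent_le_logb hk hq).trans_lt h

set_option exponentiation.threshold 40000 in
theorem immExponent_five_le : immExponent 5 ≤ 4.84438 := by
  refine (immExponent_le_logb (k := 5) (by decide) (q := 31) (by norm_num)).trans ?_
  -- `q = 31` is the best choice, where `(q + 1) ^ 5 / 2 = 2 ^ 24`; the fraction `6506 / 1343`
  -- lies between `24 * log 2 / log 31` and `4.84438`.
  have h : Real.logb (31 : ℕ) ((((31 : ℕ) : ℝ) + 1) ^ 5 / 2) ≤ 6506 / 1343 := by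
    rw [le_div_iff₀ (by norm_num), mul_comm]
    have hpow : Real.logb 31 ((2 : ℝ) ^ (24 * 1343)) ≤ 6506 := by
      rw [Real.logb_le_iff_le_rpow (by norm_num) (by positivity)]
      have : (2 : ℕ) ^ (24 * 1343) ≤ 31 ^ 6506 := by decide
      exact_mod_cast this
    rw [pow_mul, Real.logb_pow] at hpow
    have h24 : (((31 : ℕ) : ℝ) + 1) ^ 5 / 2 = 2 ^ 24 := by norm_num
    rw [h24]
    exact_mod_cast hpow
  exact h.trans (by norm_num)

/-! ### Protocols from rank decompositions -/

open scoped ComplexOrder MatrixOrder Matrix.Norms.L2Operator in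
/-- Every matrix becomes a member of a pair of Kraus operators after rescaling. -/
theorem exists_smul_kraus_completion {m n : Type} [Fintype m] [Fintype n] [DecidableEq n]
    (M : Matrix m n ℂ) : ∃ (ε : ℂ) (B : Matrix n n ℂ), ε ≠ 0 ∧
      (ε • M)ᴴ * (ε • M) + Bᴴ * B = 1 := by
  have hpos : 0 < ‖Mᴴ * M‖ + 1 := by positivity
  set c : ℝ := ‖Mᴴ * M‖ + 1 with hc
  have hle : Mᴴ * M ≤ algebraMap ℝ (Matrix n n ℂ) c :=
    (IsSelfAdjoint.le_algebraMap_norm_self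
      (Matrix.isHermitian_conjTranspose_mul_self M)).trans
      (algebraMap_mono _ (by linarith))
  have hpsd := (Matrix.le_iff.mp hle)
  have hc0 : (0 : ℝ) ≤ c⁻¹ := inv_nonneg.mpr hpos.le
  have hpsd' := hpsd.smul hc0
  obtain ⟨B, hB⟩ := CStarAlgebra.nonneg_iff_eq_star_mul_self.mp hpsd'.nonneg
  refine ⟨((Real.sqrt c)⁻¹ : ℝ), B, ?_, ?_⟩
  · exact_mod_cast (inv_ne_zero (Real.sqrt_pos.mpr hpos).ne')
  · rw [← Matrix.star_eq_conjTranspose B, ← hB, Matrix.conjTranspose_smul, Matrix.smul_mul,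
      Matrix.mul_smul, smul_smul]
    have h1 : star ((((Real.sqrt c)⁻¹ : ℝ)) : ℂ) * (((Real.sqrt c)⁻¹ : ℝ) : ℂ) =
        ((c⁻¹ : ℝ) : ℂ) := by
      rw [Complex.star_def, Complex.conj_ofReal, ← Complex.ofReal_mul, ← mul_inv,
        Real.mul_self_sqrt hpos.le]
    rw [h1, smul_sub, Algebra.algebraMap_eq_smul_one, smul_smul, inv_mul_cancel₀ hpos.ne',
      one_smul, Complex.coe_smul]
    abel

theorem ghz_ne_zero {k r : ℕ} {g : Fin k → Fin r} (h : ghz k r g ≠ 0) : ∃ b, g = fun _ => b := by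
  obtain ⟨b, _, hb⟩ := Finset.exists_ne_zero_of_sum_ne_zero h
  refine ⟨b, funext fun i => ?_⟩
  by_contra hi
  exact hb (Finset.prod_eq_zero (Finset.mem_univ i) (if_neg hi))

theorem ghz_const {k r : ℕ} (hk : 0 < k) (b : Fin r) : ghz k r (fun _ => b) = 1 := by
  rw [ghz, Finset.sum_eq_single b]
  · simp
  · exact fun a _ ha => Finset.prod_eq_zero (Finset.mem_univ ⟨0, hk⟩) (if_neg ha.symm)
  · simp

/-- A local operator applied to the shared state only sees the diagonal GHZ terms. -/
theorem applyLocal_initialState {k : ℕ} (hk : 0 < k) {X : Type} [Fintype X] [DecidableEq X]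
    (P : QProtocol k X) {O : Fin k → Type} (A : ∀ i, Matrix (O i) (X × Fin P.r) ℂ)
    (x : Fin k → X) (y : ∀ i, O i) :
    applyLocal A (P.initialState x) y = ∑ b, ∏ i, A i (y i) (x i, b) := by
  have hinj : Function.Injective
      fun (b : Fin P.r) (i : Fin k) => ((x i, b) : X × Fin P.r) := fun b b' h => by
    simpa using congrFun h ⟨0, hk⟩
  rw [applyLocal]
  symm
  refine Finset.sum_of_injOn _ hinj.injOn (fun _ _ => Finset.mem_univ _) ?_ ?_
  · intro z _ hz
    rw [mul_eq_zero]
    right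
    by_contra h
    rw [QProtocol.initialState, ← ne_eq, mul_ne_zero_iff, Finset.prod_ne_zero_iff] at h
    obtain ⟨b, hb⟩ := ghz_ne_zero h.2
    refine hz ⟨b, Finset.mem_univ _, funext fun i => Prod.ext ?_ (congrFun hb i).symm⟩
    by_contra hi
    exact h.1 i (Finset.mem_univ i) (if_neg (Ne.symm hi))
  · intro b _
    simp [QProtocol.initialState, ghz_const hk]

/-- A tensor with the same support as `f` and rank at most `r` yields a protocol with a shared
GHZ state of rank `r`: on input `x`, player `i` projects his share onto the vector of coefficients
`u a i x` (`a = 1, …, r`), rescaled so that the projection is part of a quantum operation. -/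
theorem exists_protocol_of_hasRankDecomposition {k : ℕ} (hk : 0 < k) {X : Type} [Fintype X]
    [DecidableEq X] (f : (Fin k → X) → Bool) {t : (Fin k → X) → ℂ}
    (ht : ∀ x, t x ≠ 0 ↔ f x = true) {r : ℕ} (hr : 0 < r) (h : HasRankDecomposition t r) :
    ∃ P : QProtocol k X, P.Computes f ∧ P.r = r := by
  obtain ⟨u, hu⟩ := h
  let M : Fin k → Matrix X (X × Fin r) ℂ := fun i =>
    Matrix.of fun x z => if x = z.1 then u z.2 i z.1 else 0
  choose ε B hε hB using fun i => exists_smul_kraus_completion (M i)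
  let d := Fintype.card (X × Fin r)
  let e : Fin d ≃ X × Fin r := (Fintype.equivFin _).symm
  let g₀ : Fin r := ⟨0, hr⟩
  let K₁ : Fin k → Matrix (Fin 2 × Fin d) (X × Fin r) ℂ := fun i => Matrix.of fun y z =>
    if y.1 = 1 ∧ (e y.2).2 = g₀ then (ε i • M i) (e y.2).1 z else 0
  let K₀ : Fin k → Matrix (Fin 2 × Fin d) (X × Fin r) ℂ := fun i => Matrix.of fun y z =>
    if y.1 = 0 then B i (e y.2) z else 0
  let P : QProtocol k X :=
    { r := r
      r_pos := hr
      dim := fun _ => d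
      numKraus := fun _ => 2
      kraus := fun i a => if a = 0 then K₁ i else K₀ i
      complete := by
        intro i
        rw [← hB i, Fin.sum_univ_two, if_pos rfl, if_neg one_ne_zero]
        congr 1
        · ext z z'
          simp only [Matrix.mul_apply, Matrix.conjTranspose_apply, K₁, Matrix.of_apply]
          rw [Fintype.sum_prod_type, Fin.sum_univ_two]
          simp only [zero_ne_one, false_and, if_false, mul_zero, Finset.sum_const_zero, zero_add,
            true_and]
          rw [Equiv.sum_comp e fun w => star (if w.2 = g₀ then (ε i • M i) w.1 z else 0) *
            if w.2 = g₀ then (ε i • M i) w.1 z' else 0, Fintype.sum_prod_type]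
          refine Finset.sum_congr rfl fun x _ => ?_
          rw [Finset.sum_eq_single g₀] <;> simp +contextual
        · ext z z'
          simp only [Matrix.mul_apply, Matrix.conjTranspose_apply, K₀, Matrix.of_apply]
          rw [Fintype.sum_prod_type, Fin.sum_univ_two]
          simp only [one_ne_zero, if_false, mul_zero, Finset.sum_const_zero, add_zero, if_true]
          rw [Equiv.sum_comp e fun w => star (B i w z) * B i w z'] }
  refine ⟨P, fun x => ?_, rfl⟩
  have hacc : P.acceptProb x ≠ 0 ↔ f x = true := by
    rw [QProtocol.acceptProb_ne_zero_iff, ← ht]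
    have hamp : ∀ y : Fin k → X, ∑ b, ∏ i, (ε i • M i) (y i) (x i, b) =
        if y = x then (∏ i, ε i) * t x else 0 := by
      intro y
      split_ifs with hy
      · subst hy
        simp only [hu, Matrix.smul_apply, M, Matrix.of_apply, if_true, smul_eq_mul,
          Finset.prod_mul_distrib, ← Finset.mul_sum]
      · obtain ⟨i, hi⟩ := Function.ne_iff.mp hy
        refine Finset.sum_eq_zero fun b _ => Finset.prod_eq_zero (Finset.mem_univ i) ?_
        simp [M, hi]
    constructor
    · rintro ⟨a, y, hy, h⟩
      rw [applyLocal_initialState hk] at h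
      obtain ⟨b, -, hb⟩ := Finset.exists_ne_zero_of_sum_ne_zero h
      rw [Finset.prod_ne_zero_iff] at hb
      -- All players accept only in the Kraus branch of the rescaled projections.
      have ha : ∀ i, a i = (0 : Fin 2) ∧ (e (y i).2).2 = g₀ := by
        intro i
        have := hb i (Finset.mem_univ i)
        by_cases h0 : a i = (0 : Fin 2)
        · refine ⟨h0, ?_⟩
          by_contra hg
          simp [P, h0, K₁, hg] at this
        · simp [P, h0, K₀, hy i] at this
      have : ∑ b, ∏ i, (ε i • M i) (e (y i).2).1 (x i, b) ≠ 0 := by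
        convert h using 6 with b _ i
        simp [P, K₁, ha, hy]
      rw [hamp] at this
      intro h0
      simp [h0] at this
    · intro h
      refine ⟨fun _ => (0 : Fin 2), fun i => (1, e.symm (x i, g₀)), fun _ => rfl, ?_⟩
      rw [applyLocal_initialState hk]
      have : ∑ b, ∏ i, (ε i • M i) (x i) (x i, b) ≠ 0 := by
        rw [hamp, if_pos rfl]
        exact mul_ne_zero (Finset.prod_ne_zero_iff.mpr fun i _ => hε i) h
      convert this using 6 with b _ i
      simp [P, K₁]
  refine ⟨hacc.mpr, fun hf => ?_⟩
  by_contra h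
  simp [hacc.mp h] at hf

theorem NQ_le_logb {k : ℕ} (hk : 0 < k) {X : Type} [Fintype X] [DecidableEq X] [Nonempty X]
    (f : (Fin k → X) → Bool) {t : (Fin k → X) → ℂ} (ht : ∀ x, t x ≠ 0 ↔ f x = true) {r : ℕ}
    (hr : 0 < r) (h : HasRankDecomposition t r) : NQ f ≤ Real.logb 2 r := by
  obtain ⟨P, hP, rfl⟩ := exists_protocol_of_hasRankDecomposition hk f ht hr h
  exact (NQ_isLeast hk f).2 ⟨P, hP, rfl⟩

/-! ### Cyclic equality -/

theorem NQ_cyclicEq_le {k : ℕ} (hk : 0 < k) (n : ℕ) :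
    NQ (cyclicEq n k) ≤ Real.logb 2 (tensorRank (immTensor k (2 ^ n))) := by
  refine NQ_le_logb hk _ (t := immTensor k (2 ^ n)) (fun x => ?_)
    (one_le_tensorRank_immTensor k _ (by positivity))
    (tensorRank_spec (immTensor_hasRankDecomposition k _))
  simp only [immTensor_eq_prod, Finset.prod_boole, Finset.mem_univ, forall_const, cyclicEq,
    decide_eq_true_eq, ite_ne_right_iff, ne_eq, one_ne_zero, not_false_eq_true, and_true]

theorem eventually_NQ_cyclicEq_le {k : ℕ} (hk : 0 < k) {c : ℝ} (hc : immExponent k < c) :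
    ∀ᶠ n : ℕ in atTop, NQ (cyclicEq n k) ≤ c * n := by
  obtain ⟨α, hα, -, hαc⟩ := (immExponent_isGLB k).exists_between hc
  obtain ⟨C, hC0, hC⟩ := IsBigO.exists_pos hα
  have h2 := (tendsto_pow_atTop_atTop_of_one_lt (one_lt_two (α := ℕ))).eventually hC.bound
  have h3 : ∀ᶠ n : ℕ in atTop, Real.logb 2 C ≤ (c - α) * n :=
    (tendsto_natCast_atTop_atTop.const_mul_atTop (sub_pos.mpr hαc)).eventually_ge_atTop _
  filter_upwards [h2, h3] with n hn hn'
  refine (NQ_cyclicEq_le hk n).trans ?_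
  have h1 : (0 : ℝ) < tensorRank (immTensor k (2 ^ n)) := by
    exact_mod_cast one_le_tensorRank_immTensor k (2 ^ n) (by positivity)
  rw [Real.norm_natCast, Real.norm_of_nonneg (by positivity)] at hn
  have := Real.logb_le_logb_of_le one_lt_two h1 hn
  rw [Real.logb_mul hC0.ne' (by positivity), Real.logb_rpow_eq_mul_logb_of_pos (by positivity),
    Nat.cast_pow, Real.logb_pow, Nat.cast_ofNat, Real.logb_self_eq_one one_lt_two] at this
  linarith

theorem mainTheorem2 :
    (∀ k : ℕ, Odd k → immExponent k < k) ∧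
    (∀ k : ℕ, Odd k → ∀ q : ℕ, 2 ≤ q →
      immExponent k ≤ Real.logb q (((q : ℝ) + 1) ^ k / 2)) ∧
    (∀ k : ℕ, Odd k → ∀ᶠ q : ℕ in atTop, Real.logb q (((q : ℝ) + 1) ^ k / 2) < k) ∧
    immExponent 5 ≤ 4.84438 ∧
    (∀ k : ℕ, Odd k → ∀ c : ℝ, immExponent k < c →
      ∀ᶠ n : ℕ in atTop, NQ (cyclicEq n k) ≤ c * n) ∧
    (∀ k : ℕ, Odd k → ∀ᶠ n : ℕ in atTop, NQ (cyclicEq n k) < (k : ℝ) * n) := by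
  refine ⟨fun k hk => immExponent_lt hk, fun k hk q hq => immExponent_le_logb hk hq,
    fun k _ => eventually_logb_lt k, immExponent_five_le,
    fun k hk c hc => eventually_NQ_cyclicEq_le hk.pos hc, fun k hk => ?_⟩
  obtain ⟨c, hc, hck⟩ := exists_between (immExponent_lt hk)
  filter_upwards [eventually_NQ_cyclicEq_le hk.pos hc, eventually_gt_atTop 0] with n hn hn0
  have : (0 : ℝ) < n := by exact_mod_cast hn0
  exact hn.trans_lt (by gcongr)
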